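/- Conventions. All graphs are finite and simple. For a graph $G$ let $L_G=D_G-A_G$ be its Laplacian matrix and $U_{L_G}(t)=\exp(-\mathrm{i}tL_G)$ for $t\in\mathbb{R}$. For vertices $u$, $\mathbf e_u$ is the characteristic vector of $u$, and a pair state is a vector $\mathbf e_a-\mathbf e_b$ with $a\neq b$. The graph $G$ has Laplacian perfect pair state transfer between two distinct pair states $\mathbf e_a-\mathbf e_b$ and $\mathbf e_c-\mathbf e_d$ at time $\tau$ if $U_{L_G}(\tau)(\mathbf e_a-\mathbf e_b)=\chi(\mathbf e_c-\mathbf e_d)$ for some complex number $\chi$ with $|\chi|=1$. It has Laplacian pretty good pair state transfer between them if for every $\epsilon>0$ there is a time $\tau\in\mathbb{R}$ with $\left|\tfrac12(\mathbf e_a-\mathbf e_b)^\top U_{L_G}(\tau)(\mathbf e_c-\mathbf e_d)\right|^2>1-\epsilon$. The Q-graph $\mathcal Q(G)$ is obtained from $G$ by inserting a new vertex into each edge of $G$ (subdividing it) and joining by edges those pairs of new vertices that lie on adjacent edges of $G$; thus the vertices of $G$ are also vertices of $\mathcal Q(G)$. Theorem 4.2. Let $G$ be a connected $r$-regular graph such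 that $r+1$ is prime, let $g$ be a positive integer, and suppose that $G$ has Laplacian perfect pair state transfer between $\mathbf e_a-\mathbf e_b$ and $\mathbf e_c-\mathbf e_d$ at time $\pi/g$. (a) If $G$ is non-bipartite, then $\mathcal Q(G)$ has Laplacian pretty good pair state transfer between $\mathbf e_a-\mathbf e_b$ and $\mathbf e_c-\mathbf e_d$. (b) Suppose that $G$ is bipartite with bipartition $V_1\cup V_2$. (b.1) If $a$ and $b$ lie in the same part, then $\mathcal Q(G)$ has Laplacian pretty good pair state transfer between $\mathbf e_a-\mathbf e_b$ and $\mathbf e_c-\mathbf e_d$. (b.2) If $a\in V_1$, $b\in V_2$ and $2g\mid r+2$, then $\mathcal Q(G)$ has Laplacian pretty good pair state transfer between $\mathbf e_a-\mathbf e_b$ and $\mathbf e_c-\mathbf e_d$. -/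

import Mathlib

open scoped Matrix

namespace PairTransfer

/-- The Q-graph of `G`, on the vertex set `V(G) ∪ I(G)`, where the set `I(G)` of inserted vertices is
the set of edges of `G`. Each edge of `G` is subdivided by its inserted vertex (so that no two old
vertices are adjacent and an old vertex is joined to the edges it lies on), and two inserted vertices
are joined exactly when they lie on adjacent edges, that is, on distinct edges with a common end. -/
def qGraph {V : Type*} (G : SimpleGraph V) : SimpleGraph (V ⊕ G.edgeSet) where
  Adj x y :=
    match x, y with
    | Sum.inl _, Sum.inl _ => False
    | Sum.inl u, Sum.inr e => u ∈ (e : Sym2 V)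
    | Sum.inr e, Sum.inl u => u ∈ (e : Sym2 V)
    | Sum.inr e, Sum.inr f => G.lineGraph.Adj e f
  symm := ⟨by
    rintro (u | e) (v | f) h
    · exact h
    · exact h
    · exact h
    · exact G.lineGraph.adj_symm h⟩
  loopless := ⟨by
    rintro (u | e) h
    · exact h
    · exact G.lineGraph.irrefl h⟩

noncomputable instance {V : Type*} (G : SimpleGraph V) : DecidableRel (qGraph G).Adj :=
  Classical.decRel _

/-- The transition matrix `exp(-i t L_G)` of `G` relative to its Laplacian matrix. -/
noncomputable def transitionMatrix {V : Type*} [Fintype V] [DecidableEq V]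
    (G : SimpleGraph V) [DecidableRel G.Adj] (t : ℝ) : Matrix V V ℂ :=
  NormedSpace.exp ((-Complex.I * (t : ℂ)) • G.lapMatrix ℂ)

/-- The vector `e_a - e_b`, which is a pair state when `a ≠ b`. -/
def pairState {V : Type*} [DecidableEq V] (a b : V) : V → ℂ :=
  Pi.single a 1 - Pi.single b 1

/-- Laplacian perfect pair state transfer between the distinct pair states `e_a - e_b` and
`e_c - e_d` at time `τ`. -/
def HasPairLPSTAt {V : Type*} [Fintype V] [DecidableEq V]
    (G : SimpleGraph V) [DecidableRel G.Adj] (a b c d : V) (τ : ℝ) : Prop :=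
  a ≠ b ∧ c ≠ d ∧ pairState a b ≠ pairState c d ∧
    ∃ χ : ℂ, ‖χ‖ = 1 ∧ transitionMatrix G τ *ᵥ pairState a b = χ • pairState c d

/-- Laplacian pretty good pair state transfer between `e_a - e_b` and `e_c - e_d`. -/
def HasPairLPGST {V : Type*} [Fintype V] [DecidableEq V]
    (G : SimpleGraph V) [DecidableRel G.Adj] (a b c d : V) : Prop :=
  ∀ ε : ℝ, 0 < ε → ∃ τ : ℝ,
    1 - ε < ‖(1 / 2 : ℂ) * (pairState a b ⬝ᵥ (transitionMatrix G τ *ᵥ pairState c d))‖ ^ 2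

end PairTransfer

/-! The argument compares the walk on the Q-graph with the walk on `G`, eigenvector by eigenvector of
the Laplacian of `G`.

If `x` is a Laplacian eigenvector of `G` with eigenvalue `l ≠ 2r`, then extending `x` to the edges by
suitable multiples of its edge sums gives two eigenvectors of the Q-graph, with eigenvalues
`(r + 2 + l ± √D) / 2`, where `D = (r - l)² + 4(r + 1)`, and `x` extended by zero is a combination of
the two whose coefficients add up to `1` (`exists_transitionMatrix_qGraph_apply`). So at time `τ`
the walk on the Q-graph multiplies `x`, up to the common phase `exp(-iτ(r + 2)/2)`, by `exp(-iτl/2)`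
times an average of `exp(±iτ√D/2)`. If `l` is an integer and `τ = 2π/g + 4πm`, the factor
`exp(-iτl/2)` is `exp(-iπl/g)`, the phase of the walk on `G` at time `π/g`. It remains to choose `m` so
that `exp(±iτ√D/2)` is close to `1` for all `l` in the support of the initial pair state at once.

Three facts make this possible. Perfect transfer at time `π/g` forces the eigenvalues in the support
to differ by integers, and then to be integers (`exists_int_eq_of_hasPairLPSTAt`). As `r + 1` is prime,
the integer `D` is a perfect square only for `l = 0` and `l = 2r`
(`eq_zero_or_eq_two_mul_of_isSquare`). Finally, an integral combination of irrational square roots of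
integers can be an integer only if it vanishes (`eq_zero_of_sum_int_mul_sqrt_eq`), which is the
condition under which a Kronecker-type theorem, proved by Bohr's averaging method, provides `m`
(`exists_seq_tendsto_exp_sqrt`).

The eigenvalue `0` of a connected graph has constant eigenvectors, which are orthogonal to pair
states. An eigenvector for `2r` changes sign along every edge: it does not exist if `G` is not
bipartite, and it is orthogonal to a pair state inside one part. In the remaining case the vector
extended by zero is itself an eigenvector of the Q-graph, with eigenvalue `r`, and `2g ∣ r + 2` is
what puts its phase in step with the others. -/

namespace PairTransfer

open Filter Topology

/-! ### Simultaneous approximation -/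

/-- An integral combination of irrational square roots is an integer only if it vanishes: the
normalized trace over `ℚ` fixes rational numbers and kills irrational square roots. -/
theorem eq_zero_of_sum_int_mul_sqrt_eq {J : Type*} [Fintype J] (d : J → ℕ)
    (hd : ∀ j, ¬ IsSquare (d j)) (n : J → ℤ) (q : ℤ)
    (h : ∑ j, (n j : ℝ) * √(d j : ℝ) = q) : q = 0 := by
  have hint : ∀ j, IsIntegral ℚ (√(d j : ℝ)) := fun j =>
    ⟨Polynomial.X ^ 2 - Polynomial.C (d j : ℚ), Polynomial.monic_X_pow_sub_C _ two_ne_zero, by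
      simp⟩
  let K := algebraicClosure ℚ ℝ
  let s : J → K := fun j => ⟨√(d j : ℝ), (mem_algebraicClosure_iff).2 (hint j).isAlgebraic⟩
  have : Algebra.IsIntegral ℚ K := (algebraicClosure.isAlgebraic ℚ ℝ).isIntegral
  have hT : ∀ j, Algebra.normalizedTrace ℚ K (s j) = 0 := by
    intro j
    have hmin : minpoly ℚ (s j) = Polynomial.X ^ 2 - Polynomial.C (d j : ℚ) := by
      symm
      apply minpoly.eq_of_irreducible_of_monic
      · rw [Polynomial.irreducible_iff_roots_eq_zero_of_degree_le_three]
        · rw [Multiset.eq_zero_iff_forall_notMem]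
          intro a ha
          rw [Polynomial.mem_roots', Polynomial.IsRoot.def] at ha
          have h2 : a * a = (d j : ℚ) := by
            have := ha.2
            simp only [Polynomial.eval_sub, Polynomial.eval_pow, Polynomial.eval_X,
              Polynomial.eval_C] at this
            linarith
          exact hd j (Rat.isSquare_natCast_iff.1 ⟨a, h2.symm⟩)
        · rw [Polynomial.natDegree_X_pow_sub_C]
        · rw [Polynomial.natDegree_X_pow_sub_C]; norm_num
      · apply Subtype.ext
        simp [s]
      · exact Polynomial.monic_X_pow_sub_C _ two_ne_zero
    rw [Algebra.normalizedTrace_minpoly, hmin]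
    have : (Polynomial.X ^ 2 - Polynomial.C (d j : ℚ)).nextCoeff = 0 := by
      rw [Polynomial.nextCoeff_of_natDegree_pos]
      · rw [Polynomial.natDegree_X_pow_sub_C]; simp [Polynomial.coeff_X_pow]
      · rw [Polynomial.natDegree_X_pow_sub_C]; norm_num
    rw [this]; simp
  have hs : ∑ j, (n j : ℚ) • s j = (q : ℚ) • (1 : K) := by
    apply Subtype.ext
    have h1 : ((∑ j, (n j : ℚ) • s j : K) : ℝ) = ∑ j, (n j : ℝ) * √(d j : ℝ) := by
      rw [IntermediateField.coe_sum]
      exact Finset.sum_congr rfl fun j _ => by simp [s, Rat.smul_def]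
    rw [h1, h]
    simp
  have h1 := congrArg (Algebra.normalizedTrace ℚ K) hs
  have h2 : Algebra.normalizedTrace ℚ K 1 = 1 := by
    rw [Algebra.normalizedTrace_minpoly, minpoly.one, ← map_one Polynomial.C,
      Polynomial.nextCoeff_X_sub_C, Polynomial.natDegree_X_sub_C]
    simp
  rw [map_sum, map_smul, h2] at h1
  simp only [map_smul, hT, smul_eq_mul, mul_one, mul_zero, Finset.sum_const_zero] at h1
  exact_mod_cast h1.symm

theorem tendsto_average_pow {z : ℂ} (hz : ‖z‖ = 1) (hz1 : z ≠ 1) :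
    Tendsto (fun M : ℕ => (M : ℂ)⁻¹ * ∑ m ∈ Finset.range M, z ^ m) atTop (𝓝 0) := by
  have h1 : Tendsto (fun M : ℕ => (M : ℝ)⁻¹ * (2 / ‖z - 1‖)) atTop (𝓝 0) := by
    simpa using tendsto_inv_atTop_nhds_zero_nat.mul_const (2 / ‖z - 1‖)
  refine squeeze_zero_norm (fun M => ?_) h1
  rw [geom_sum_eq hz1, norm_mul, norm_inv, Complex.norm_natCast, norm_div]
  gcongr
  calc ‖z ^ M - 1‖ ≤ ‖z ^ M‖ + ‖(1 : ℂ)‖ := norm_sub_le _ _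
    _ = 2 := by simp [hz]; norm_num

/-- The mean square of an exponential sum bounds the sum of the squared moduli of its coefficients
when terms of equal frequency do not cancel (Bohr). -/
theorem sum_normSq_le_of_exponentialSum_le {I : Type*} (A : Finset I) (w z : I → ℂ)
    (hz : ∀ i ∈ A, ‖z i‖ = 1)
    (hw : ∀ i ∈ A, ∀ j ∈ A, z i = z j → 0 ≤ (w i * (starRingEnd ℂ) (w j)).re) (B : ℝ)
    (hB : ∀ m : ℕ, ‖∑ i ∈ A, w i * z i ^ m‖ ^ 2 ≤ B) :
    ∑ i ∈ A, ‖w i‖ ^ 2 ≤ B := by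
  classical
  have hlim : Tendsto (fun M : ℕ => (M : ℂ)⁻¹ * ∑ m ∈ Finset.range M,
      (∑ i ∈ A, w i * z i ^ m) * (starRingEnd ℂ) (∑ i ∈ A, w i * z i ^ m)) atTop
      (𝓝 (∑ i ∈ A, ∑ j ∈ A, w i * (starRingEnd ℂ) (w j) * if z i = z j then 1 else 0)) := by
    have hrw : (fun M : ℕ => (M : ℂ)⁻¹ * ∑ m ∈ Finset.range M,
        (∑ i ∈ A, w i * z i ^ m) * (starRingEnd ℂ) (∑ i ∈ A, w i * z i ^ m)) =
        fun M : ℕ => ∑ i ∈ A, ∑ j ∈ A, w i * (starRingEnd ℂ) (w j) *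
          ((M : ℂ)⁻¹ * ∑ m ∈ Finset.range M, (z i * (starRingEnd ℂ) (z j)) ^ m) := by
      funext M
      simp only [map_sum, Finset.sum_mul_sum]
      rw [Finset.sum_comm, Finset.mul_sum]
      refine Finset.sum_congr rfl fun i _ => ?_
      rw [Finset.sum_comm, Finset.mul_sum]
      refine Finset.sum_congr rfl fun j _ => ?_
      rw [← mul_assoc, mul_comm (w i * _), mul_assoc]
      refine congrArg _ ?_
      rw [Finset.mul_sum]
      refine Finset.sum_congr rfl fun m _ => ?_
      simp only [map_mul, map_pow, mul_pow]
      ring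
    rw [hrw]
    refine tendsto_finsetSum _ fun i hi => tendsto_finsetSum _ fun j hj => ?_
    refine Tendsto.const_mul _ ?_
    have hj1 : z j * (starRingEnd ℂ) (z j) = 1 := by
      rw [Complex.mul_conj, Complex.normSq_eq_norm_sq, hz j hj]; simp
    by_cases hij : z i = z j
    · rw [if_pos hij, hij, hj1]
      refine tendsto_const_nhds.congr' ?_
      filter_upwards [eventually_ge_atTop 1] with M hM
      have : (M : ℂ) ≠ 0 := by exact_mod_cast (by omega : M ≠ 0)
      simp [this]
    · rw [if_neg hij]
      refine tendsto_average_pow (by simp [hz i hi, hz j hj]) fun h => hij ?_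
      calc z i = z i * (z j * (starRingEnd ℂ) (z j)) := by rw [hj1, mul_one]
        _ = (z i * (starRingEnd ℂ) (z j)) * z j := by ring
        _ = z j := by rw [h, one_mul]
  have hre := (Complex.continuous_re.tendsto _).comp hlim
  have hle : (∑ i ∈ A, ∑ j ∈ A,
      w i * (starRingEnd ℂ) (w j) * if z i = z j then 1 else 0).re ≤ B := by
    refine le_of_tendsto hre ?_
    filter_upwards [eventually_ge_atTop 1] with M hM
    have hM0 : (0 : ℝ) < M := by exact_mod_cast hM
    have : ((M : ℂ)⁻¹ * ∑ m ∈ Finset.range M,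
        (∑ i ∈ A, w i * z i ^ m) * (starRingEnd ℂ) (∑ i ∈ A, w i * z i ^ m)) =
        (((M : ℝ)⁻¹ * ∑ m ∈ Finset.range M, ‖∑ i ∈ A, w i * z i ^ m‖ ^ 2 : ℝ) : ℂ) := by
      push_cast
      congr 1
      refine Finset.sum_congr rfl fun m _ => ?_
      rw [Complex.mul_conj, Complex.normSq_eq_norm_sq]
      push_cast; rfl
    simp only [Function.comp_apply]
    rw [this, Complex.ofReal_re]
    calc (M : ℝ)⁻¹ * ∑ m ∈ Finset.range M, ‖∑ i ∈ A, w i * z i ^ m‖ ^ 2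
        ≤ (M : ℝ)⁻¹ * ∑ m ∈ Finset.range M, B := by gcongr with m; exact hB m
      _ = B := by simp; field_simp
  refine le_trans ?_ hle
  rw [Complex.re_sum]
  refine Finset.sum_le_sum fun i hi => ?_
  rw [Complex.re_sum]
  have hi' : ‖w i‖ ^ 2 = (w i * (starRingEnd ℂ) (w i) * if z i = z i then 1 else 0).re := by
    rw [if_pos rfl, mul_one, Complex.mul_conj, Complex.normSq_eq_norm_sq, Complex.ofReal_re]
  rw [hi']
  refine Finset.single_le_sum (f := fun j =>
    (w i * (starRingEnd ℂ) (w j) * if z i = z j then 1 else 0).re) (fun j hj => ?_) hi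
  by_cases hij : z i = z j
  · simpa [hij] using hw i hi j hj hij
  · simp [hij]

/-- If every multiplicative relation between the frequencies `z j` also holds between the phases
`β j`, the triangle inequality for `∑ j, β j * z j ^ m` is nearly attained for some `m`: otherwise
powers of the sum would have a mean square smaller than that of their multinomial coefficients. -/
theorem exists_norm_sum_gt {J : Type*} [Fintype J] (β z : J → ℂ)
    (hβ : ∀ j, ‖β j‖ = 1) (hz : ∀ j, ‖z j‖ = 1)
    (hrel : ∀ k l : J → ℕ, ∏ j, z j ^ k j = ∏ j, z j ^ l j → ∏ j, β j ^ k j = ∏ j, β j ^ l j)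
    (B : ℝ) (hBJ : B < Fintype.card J) : ∃ m : ℕ, B < ‖∑ j, β j * z j ^ m‖ := by
  classical
  by_contra! hcon
  set D := Fintype.card J with hD
  have hB0 : 0 ≤ B := (norm_nonneg _).trans (hcon 0)
  have hD0 : (0 : ℝ) < D := hB0.trans_lt hBJ
  obtain ⟨C, hBC, hCD⟩ := exists_between hBJ
  have hC0 : 0 < C := hB0.trans_lt hBC
  have key : ∀ K : ℕ, ((D : ℝ) ^ K) ^ 2 ≤ ((K : ℝ) + 1) ^ D * (C ^ K) ^ 2 := by
    intro K
    set A := (Finset.univ : Finset J).piAntidiag K with hA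
    have hcard : (A.card : ℝ) ≤ ((K : ℝ) + 1) ^ D := by
      have : A ⊆ Fintype.piFinset fun _ : J => Finset.range (K + 1) := by
        intro k hk
        rw [hA, Finset.mem_piAntidiag] at hk
        rw [Fintype.mem_piFinset]
        intro j
        rw [Finset.mem_range, Nat.lt_succ_iff, ← hk.1]
        exact Finset.single_le_sum (f := k) (fun _ _ => Nat.zero_le _) (Finset.mem_univ j)
      have h2 := Finset.card_le_card this
      rw [Fintype.card_piFinset] at h2
      simp only [Finset.card_range, Finset.prod_const, Finset.card_univ] at h2
      exact_mod_cast h2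
    have hsum : ∑ k ∈ A, (Nat.multinomial Finset.univ k : ℝ) = (D : ℝ) ^ K := by
      have := Finset.sum_pow_eq_sum_piAntidiag (Finset.univ : Finset J) (fun _ => (1 : ℝ)) K
      simpa [hD] using this.symm
    have hmean := sum_normSq_le_of_exponentialSum_le A
      (fun k => (Nat.multinomial Finset.univ k : ℂ) * ∏ j, β j ^ k j)
      (fun k => ∏ j, z j ^ k j) (fun k _ => by simp [norm_prod, hz])
      (fun k _ l _ hkl => by
        rw [hrel k l hkl, map_mul, mul_mul_mul_comm, Complex.mul_conj, map_natCast]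
        have : (Complex.normSq (∏ j, β j ^ l j)) = 1 := by
          rw [Complex.normSq_eq_norm_sq]; simp [norm_prod, hβ]
        rw [this, Complex.ofReal_one, mul_one]
        norm_cast
        exact Nat.zero_le _) ((C ^ K) ^ 2) (fun m => by
        have : ∑ k ∈ A, ((Nat.multinomial Finset.univ k : ℂ) * ∏ j, β j ^ k j) *
            (∏ j, z j ^ k j) ^ m = (∑ j, β j * z j ^ m) ^ K := by
          rw [Finset.sum_pow_eq_sum_piAntidiag]
          refine Finset.sum_congr rfl fun k _ => ?_
          rw [mul_assoc, ← Finset.prod_pow, ← Finset.prod_mul_distrib]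
          congr 1
          refine Finset.prod_congr rfl fun j _ => ?_
          rw [mul_pow, ← pow_mul, ← pow_mul, mul_comm m]
        rw [this, norm_pow]
        have := (hcon m).trans hBC.le
        gcongr)
    calc ((D : ℝ) ^ K) ^ 2 = (∑ k ∈ A, (Nat.multinomial Finset.univ k : ℝ)) ^ 2 := by rw [hsum]
      _ ≤ A.card * ∑ k ∈ A, (Nat.multinomial Finset.univ k : ℝ) ^ 2 :=
        sq_sum_le_card_mul_sum_sq
      _ ≤ ((K : ℝ) + 1) ^ D * (C ^ K) ^ 2 := by
        refine mul_le_mul hcard ?_ (Finset.sum_nonneg fun _ _ => sq_nonneg _) (by positivity)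
        simpa [norm_prod, hβ] using hmean
  -- Exponential decay of `(C / D) ^ (2 * K)` beats the polynomial number of multi-indices.
  set ρ := (C / D) ^ 2 with hρ
  have hρ0 : 0 < ρ := by positivity
  have hρ1 : ρ < 1 := by
    rw [hρ]
    exact pow_lt_one₀ (by positivity) ((div_lt_one hD0).2 hCD) two_ne_zero
  have hlim := (tendsto_add_atTop_iff_nat 1).2
    (tendsto_pow_const_mul_const_pow_of_abs_lt_one D (r := ρ) (by rwa [abs_of_pos hρ0]))
  obtain ⟨K, hK⟩ := (hlim.eventually_lt_const hρ0).exists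
  have h1 : (1 : ℝ) ≤ ((K : ℝ) + 1) ^ D * ρ ^ K := by
    have := key K
    rw [hρ, ← pow_mul, mul_comm 2 K, pow_mul, div_pow, div_pow, ← mul_div_assoc,
      le_div_iff₀ (by positivity), one_mul]
    exact this
  push_cast at hK
  rw [pow_succ, ← mul_assoc] at hK
  nlinarith

/-- **Kronecker's theorem**, in multiplicative form: if every multiplicative relation between the
unimodular numbers `z j` also holds between the `β j`, then powers of the `z j` approximate the
inverses of the `β j` simultaneously. -/
theorem exists_seq_tendsto_mul_pow {J : Type*} [Fintype J] (β z : J → ℂ)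
    (hβ : ∀ j, ‖β j‖ = 1) (hz : ∀ j, ‖z j‖ = 1)
    (hrel : ∀ k l : J → ℕ, ∏ j, z j ^ k j = ∏ j, z j ^ l j → ∏ j, β j ^ k j = ∏ j, β j ^ l j) :
    ∃ m : ℕ → ℕ, ∀ j, Tendsto (fun n => β j * z j ^ m n) atTop (𝓝 1) := by
  classical
  -- Adjoining the constant term `1` forces all terms of the sum to align with `1`.
  have hex : ∀ n : ℕ, ∃ m : ℕ,
      (Fintype.card J + 1 : ℝ) - 1 / ((n : ℝ) + 1) < ‖1 + ∑ j, β j * z j ^ m‖ := by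
    intro n
    obtain ⟨m, hm⟩ := exists_norm_sum_gt (J := Option J) (fun o => o.elim 1 β)
      (fun o => o.elim 1 z) (by rintro (_ | j) <;> simp [hβ]) (by rintro (_ | j) <;> simp [hz])
      (by
        intro k l hkl
        simp only [Fintype.prod_option, Option.elim_none, Option.elim_some, one_pow, one_mul]
          at hkl ⊢
        exact hrel _ _ hkl) ((Fintype.card J + 1 : ℝ) - 1 / ((n : ℝ) + 1))
      (by rw [Fintype.card_option]; push_cast
          have : (0 : ℝ) < 1 / ((n : ℝ) + 1) := by positivity
          linarith)
    exact ⟨m, by simpa [Fintype.sum_option] using hm⟩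
  choose m hm using hex
  refine ⟨m, fun j => ?_⟩
  have hunit : ∀ i n, ‖β i * z i ^ m n‖ = 1 := fun i n => by simp [hβ, hz]
  have hnear : ∀ n : ℕ, 2 - 1 / ((n : ℝ) + 1) ≤ ‖1 + β j * z j ^ m n‖ := by
    intro n
    have h1 : ‖1 + ∑ i, β i * z i ^ m n‖ ≤
        ‖1 + β j * z j ^ m n‖ + (Fintype.card J - 1 : ℝ) := by
      rw [← Finset.add_sum_erase _ _ (Finset.mem_univ j), ← add_assoc]
      refine (norm_add_le _ _).trans ?_
      gcongr
      refine (norm_sum_le _ _).trans ?_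
      simp only [hunit, Finset.sum_const, nsmul_eq_mul, mul_one]
      rw [Finset.card_erase_of_mem (Finset.mem_univ j), Finset.card_univ, Nat.cast_sub]
      · simp
      · exact Fintype.card_pos_iff.2 ⟨j⟩
    linarith [hm n]
  rw [tendsto_iff_norm_sub_tendsto_zero]
  have hsq : Tendsto (fun n => ‖β j * z j ^ m n - 1‖ ^ 2) atTop (𝓝 0) := by
    have hlim : Tendsto (fun n : ℕ => 4 * (1 / ((n : ℝ) + 1))) atTop (𝓝 0) := by
      simpa using tendsto_one_div_add_atTop_nhds_zero_nat.const_mul (4 : ℝ)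
    refine squeeze_zero (fun n => by positivity) (fun n => ?_) hlim
    -- The parallelogram law in the plane.
    have hp := parallelogram_law_with_norm ℝ (β j * z j ^ m n) 1
    rw [hunit, norm_one, add_comm (β j * z j ^ m n) 1] at hp
    have h1 := hnear n
    have h2 : (1 : ℝ) / ((n : ℝ) + 1) ≤ 1 := by
      rw [div_le_one (by positivity)]; linarith [Nat.cast_nonneg (α := ℝ) n]
    nlinarith [norm_nonneg (1 + β j * z j ^ m n), sq_nonneg (1 / ((n : ℝ) + 1))]
  have := hsq.sqrt
  simpa [Real.sqrt_sq] using this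

/-- Irrational square roots, multiplied by suitable numbers `s + m` with `m` integral, can be brought
simultaneously close to integers. -/
theorem exists_seq_tendsto_exp_sqrt {J : Type*} [Fintype J] (d : J → ℕ)
    (hd : ∀ j, ¬ IsSquare (d j)) (s : ℝ) :
    ∃ m : ℕ → ℕ, ∀ j, Tendsto
      (fun n => Complex.exp ((2 * Real.pi * √(d j : ℝ) * (s + m n) : ℝ) * Complex.I))
      atTop (𝓝 1) := by
  obtain ⟨m, hm⟩ := exists_seq_tendsto_mul_pow
    (fun j => Complex.exp ((2 * Real.pi * √(d j : ℝ) * s : ℝ) * Complex.I))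
    (fun j => Complex.exp ((2 * Real.pi * √(d j : ℝ) : ℝ) * Complex.I))
    (fun j => Complex.norm_exp_ofReal_mul_I _) (fun j => Complex.norm_exp_ofReal_mul_I _)
    (by
      intro k l hkl
      simp only [← Complex.exp_nat_mul, ← Complex.exp_sum] at hkl ⊢
      obtain ⟨q, hq⟩ := Complex.exp_eq_exp_iff_exists_int.1 hkl
      have hI := Complex.I_ne_zero
      have hpi : (Real.pi : ℂ) ≠ 0 := by exact_mod_cast Real.pi_ne_zero
      have h1 : ∑ j, ((k j : ℝ) - l j) * √(d j : ℝ) = q := by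
        have h2 : (2 * Real.pi * Complex.I) * ∑ j, ((k j : ℂ) - l j) * (√(d j : ℝ) : ℂ) =
            (2 * Real.pi * Complex.I) * q := by
          rw [mul_comm _ (q : ℂ), ← sub_eq_iff_eq_add'.2 hq, ← Finset.sum_sub_distrib,
            Finset.mul_sum]
          refine Finset.sum_congr rfl fun j _ => ?_
          push_cast; ring
        have h3 := mul_left_cancel₀ (by simp [hpi, hI]) h2
        exact_mod_cast h3
      have hq0 := eq_zero_of_sum_int_mul_sqrt_eq d hd (fun j => (k j : ℤ) - l j) q
        (by push_cast; exact h1)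
      rw [hq0, Int.cast_zero] at h1
      congr 1
      rw [← sub_eq_zero, ← Finset.sum_sub_distrib]
      have h4 : ∑ j, ((k j : ℂ) - l j) * (√(d j : ℝ) : ℂ) = 0 := by exact_mod_cast h1
      calc _ = (2 * Real.pi * s * Complex.I) * ∑ j, ((k j : ℂ) - l j) * (√(d j : ℝ) : ℂ) := by
            rw [Finset.mul_sum]
            refine Finset.sum_congr rfl fun j _ => ?_
            push_cast; ring
        _ = 0 := by rw [h4, mul_zero])
  refine ⟨m, fun j => (hm j).congr fun n => ?_⟩
  rw [← Complex.exp_nat_mul, ← Complex.exp_add]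
  congr 1
  push_cast; ring

/-! ### Integrality of the eigenvalues in the support of a vector -/

theorem aeval_mulVec_of_eigenvector {V R : Type*} [Fintype V] [DecidableEq V] [CommRing R]
    {M : Matrix V V R} {x : V → R} {l : R} (hx : M *ᵥ x = l • x) (Q : Polynomial R) :
    Polynomial.aeval M Q *ᵥ x = Q.eval l • x := by
  induction Q using Polynomial.induction_on' with
  | add p q hp hq => simp [Matrix.add_mulVec, hp, hq, add_smul]
  | monomial n a =>
    have hpow : ∀ n : ℕ, M ^ n *ᵥ x = l ^ n • x := by
      intro n
      induction n with
      | zero => simp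
      | succ n ih => rw [pow_succ, ← Matrix.mulVec_mulVec, hx, Matrix.mulVec_smul, ih, smul_smul,
          pow_succ, mul_comm]
    rw [Polynomial.aeval_monomial, Polynomial.eval_monomial, ← Algebra.smul_def,
      Matrix.smul_mulVec, hpow, smul_smul]

theorem dotProduct_aeval_mulVec {V R : Type*} [Fintype V] [DecidableEq V] [CommRing R]
    {M : Matrix V V R} (hM : M.IsSymm) {x : V → R} {l : R} (hx : M *ᵥ x = l • x)
    (Q : Polynomial R) (u : V → R) :
    x ⬝ᵥ (Polynomial.aeval M Q *ᵥ u) = Q.eval l * (x ⬝ᵥ u) := by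
  have hT : (Polynomial.aeval M Q)ᵀ = Polynomial.aeval M Q := by
    induction Q using Polynomial.induction_on' with
    | add p q hp hq => simp [hp, hq]
    | monomial n a =>
      rw [Polynomial.aeval_monomial, ← Algebra.smul_def, Matrix.transpose_smul,
        Matrix.transpose_pow, hM.eq]
  rw [Matrix.dotProduct_mulVec, ← Matrix.mulVec_transpose, hT, aeval_mulVec_of_eigenvector hx,
    smul_dotProduct, smul_eq_mul]

theorem eq_zero_of_forall_eigenvectorBasis_dotProduct {V : Type*} [Fintype V] [DecidableEq V]
    {M : Matrix V V ℝ} (hM : M.IsHermitian) (w : V → ℝ)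
    (h : ∀ i, (hM.eigenvectorBasis i).ofLp ⬝ᵥ w = 0) : w = 0 := by
  have hw : (WithLp.toLp 2 w : EuclideanSpace ℝ V) = 0 := by
    rw [← hM.eigenvectorBasis.sum_repr (WithLp.toLp 2 w)]
    refine Finset.sum_eq_zero fun i _ => ?_
    rw [OrthonormalBasis.repr_apply_apply, EuclideanSpace.inner_eq_star_dotProduct]
    rw [star_trivial, dotProduct_comm, h i, zero_smul]
  simpa using congrArg WithLp.ofLp hw

/-- If the eigenvalues in the support of an integral vector `u` differ by integers, they are
integers. The polynomial `P` with these roots has minimal degree among those with `P(A) u = 0`, so it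
is unchanged when a `ℚ`-linear retraction `ℝ → ℚ` is applied to its coefficients; hence the sum of its
roots is rational. Together with the integral differences this makes each root rational, and an
eigenvalue of an integral matrix is an algebraic integer. -/
theorem exists_int_eq_of_eigenvalue_differences {V : Type*} [Fintype V] [DecidableEq V]
    (A : Matrix V V ℤ) (hA : A.IsSymm) (u : V → ℤ)
    (hdiff : ∀ (l l' : ℝ) (x x' : V → ℝ), A.map (Int.cast : ℤ → ℝ) *ᵥ x = l • x →
      A.map (Int.cast : ℤ → ℝ) *ᵥ x' = l' • x' → x ⬝ᵥ (fun v => (u v : ℝ)) ≠ 0 →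
      x' ⬝ᵥ (fun v => (u v : ℝ)) ≠ 0 → ∃ z : ℤ, l - l' = z)
    (l : ℝ) (x : V → ℝ) (hx : A.map (Int.cast : ℤ → ℝ) *ᵥ x = l • x)
    (hxu : x ⬝ᵥ (fun v => (u v : ℝ)) ≠ 0) : ∃ z : ℤ, l = z := by
  classical
  set M : Matrix V V ℝ := A.map (Int.cast : ℤ → ℝ) with hMdef
  set U : V → ℝ := fun v => (u v : ℝ) with hU
  have hMs : M.IsSymm := by
    rw [hMdef]; exact hA.map _
  have hM : M.IsHermitian := by
    rw [Matrix.IsHermitian, Matrix.conjTranspose_eq_transpose_of_trivial]; exact hMs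
  let e : V → V → ℝ := fun i => (hM.eigenvectorBasis i).ofLp
  have he : ∀ i, M *ᵥ e i = hM.eigenvalues i • e i := fun i => hM.mulVec_eigenvectorBasis i
  let S : Finset ℝ := (Finset.univ.filter fun i => e i ⬝ᵥ U ≠ 0).image hM.eigenvalues
  have hSmem : ∀ k ∈ S, ∃ i, e i ⬝ᵥ U ≠ 0 ∧ hM.eigenvalues i = k := by
    intro k hk
    simpa [S] using hk
  let P : Polynomial ℝ := ∏ k ∈ S, (Polynomial.X - Polynomial.C k)
  have hPmonic : P.Monic := Polynomial.monic_prod_of_monic _ _ fun k _ => Polynomial.monic_X_sub_C k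
  have hPdeg : P.natDegree = S.card := Polynomial.natDegree_finsetProd_X_sub_C_eq_card S fun k => k
  have hPS : ∀ k ∈ S, P.eval k = 0 := by
    intro k hk
    rw [Polynomial.eval_prod]
    exact Finset.prod_eq_zero hk (by simp)
  have hPu : Polynomial.aeval M P *ᵥ U = 0 := by
    refine eq_zero_of_forall_eigenvectorBasis_dotProduct hM _ fun i => ?_
    rw [dotProduct_aeval_mulVec hMs (he i)]
    by_cases hi : e i ⬝ᵥ U = 0
    · exact mul_eq_zero_of_right _ hi
    · rw [hPS _ (Finset.mem_image_of_mem _ (by simpa using hi)), zero_mul]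
  have hlS : l ∈ S := by
    have h1 := dotProduct_aeval_mulVec hMs hx P U
    rw [hPu, dotProduct_zero] at h1
    have h2 : P.eval l = 0 := (mul_eq_zero.1 h1.symm).resolve_right hxu
    rw [Polynomial.eval_prod, Finset.prod_eq_zero_iff] at h2
    obtain ⟨k, hk, h3⟩ := h2
    simp only [Polynomial.eval_sub, Polynomial.eval_X, Polynomial.eval_C] at h3
    rwa [sub_eq_zero.1 h3]
  -- A `ℚ`-linear retraction of `ℝ` onto `ℚ`, applied to the coefficients of `P`.
  obtain ⟨φ, hφ⟩ := LinearMap.exists_leftInverse_of_injective (Algebra.linearMap ℚ ℝ)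
    (LinearMap.ker_eq_bot.2 (algebraMap ℚ ℝ).injective)
  have hφ1 : ∀ q : ℚ, φ (q : ℝ) = q := fun q => by
    simpa using LinearMap.congr_fun hφ q
  let Q : Polynomial ℝ := ∑ k ∈ Finset.range (S.card + 1),
    Polynomial.C ((φ (P.coeff k) : ℚ) : ℝ) * Polynomial.X ^ k
  have hQcoeff : ∀ k, Q.coeff k = ((φ (P.coeff k) : ℚ) : ℝ) := by
    intro k
    simp only [Q, Polynomial.finsetSum_coeff, Polynomial.coeff_C_mul_X_pow,
      Finset.sum_ite_eq, Finset.mem_range]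
    split_ifs with hk
    · rfl
    · rw [Polynomial.coeff_eq_zero_of_natDegree_lt (by omega), map_zero, Rat.cast_zero]
  have hint : ∀ (k : ℕ) (v : V), (M ^ k *ᵥ U) v = (((A ^ k *ᵥ u) v : ℤ) : ℝ) := by
    intro k v
    have h1 : M ^ k = (A ^ k).map (Int.cast : ℤ → ℝ) := by
      simpa [hMdef] using (Matrix.map_pow A (Int.castRingHom ℝ) k).symm
    rw [h1]
    simp [Matrix.mulVec, dotProduct, hU]
  have hexp : ∀ (R : Polynomial ℝ), R.natDegree ≤ S.card → ∀ v,
      (Polynomial.aeval M R *ᵥ U) v =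
        ∑ k ∈ Finset.range (S.card + 1), R.coeff k * (((A ^ k *ᵥ u) v : ℤ) : ℝ) := by
    intro R hR v
    rw [Polynomial.aeval_eq_sum_range' (Nat.lt_succ_of_le hR), Matrix.sum_mulVec, Finset.sum_apply]
    refine Finset.sum_congr rfl fun k _ => ?_
    rw [Matrix.smul_mulVec, Pi.smul_apply, hint, smul_eq_mul]
  have hQdeg : Q.natDegree ≤ S.card := by
    rw [Polynomial.natDegree_le_iff_coeff_eq_zero]
    intro k hk
    rw [hQcoeff, Polynomial.coeff_eq_zero_of_natDegree_lt (by omega), map_zero, Rat.cast_zero]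
  have hQu : Polynomial.aeval M Q *ᵥ U = 0 := by
    funext v
    have h1 := congrArg φ (congrFun hPu v)
    rw [hexp P hPdeg.le v, Pi.zero_apply, map_zero, map_sum] at h1
    rw [hexp Q hQdeg v, Pi.zero_apply, ← Rat.cast_zero, ← h1, Rat.cast_sum]
    refine Finset.sum_congr rfl fun k _ => ?_
    have h2 : P.coeff k * (((A ^ k *ᵥ u) v : ℤ) : ℝ) =
        (((A ^ k *ᵥ u) v : ℤ) : ℚ) • P.coeff k := by
      rw [Rat.smul_def]; push_cast; ring
    rw [h2, map_smul, hQcoeff, smul_eq_mul]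
    push_cast; ring
  have hQS : ∀ k ∈ S, Q.eval k = 0 := by
    intro k hk
    obtain ⟨i, hi, rfl⟩ := hSmem k hk
    have h1 := dotProduct_aeval_mulVec hMs (he i) Q U
    rw [hQu, dotProduct_zero] at h1
    exact (mul_eq_zero.1 h1.symm).resolve_right hi
  have hPQ : P = Q := by
    refine Polynomial.eq_of_degree_sub_lt_of_eval_finset_eq S ?_
      fun k hk => by rw [hPS k hk, hQS k hk]
    rw [Polynomial.degree_lt_iff_coeff_zero]
    intro k hk
    rw [Polynomial.coeff_sub, hQcoeff]
    rcases hk.eq_or_lt with rfl | hk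
    · have h1 : P.coeff S.card = 1 := by rw [← hPdeg]; exact hPmonic
      have h2 := hφ1 1
      rw [Rat.cast_one] at h2
      rw [h1, h2, Rat.cast_one, sub_self]
    · rw [Polynomial.coeff_eq_zero_of_natDegree_lt (by omega), map_zero, Rat.cast_zero, sub_self]
  have hcard : 0 < S.card := Finset.card_pos.2 ⟨l, hlS⟩
  have hsum : ∃ q : ℚ, ∑ k ∈ S, k = q := by
    have h1 : P.nextCoeff = -∑ k ∈ S, k := Polynomial.prod_X_sub_C_nextCoeff (fun k => k)
    rw [Polynomial.nextCoeff_of_natDegree_pos (by omega), hPQ, hQcoeff] at h1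
    exact ⟨-φ (P.coeff (Q.natDegree - 1)), by push_cast; linarith⟩
  obtain ⟨q, hq⟩ := hsum
  have hz : ∀ k ∈ S, ∃ z : ℤ, l - k = z := by
    intro k hk
    obtain ⟨i, hi, rfl⟩ := hSmem k hk
    exact hdiff _ _ _ _ hx (he i) hxu hi
  choose! z hz using hz
  have hlq : l = (((q + ∑ k ∈ S, (z k : ℚ)) / S.card : ℚ) : ℝ) := by
    have h1 : ∑ k ∈ S, (l - k) = ∑ k ∈ S, (z k : ℝ) := Finset.sum_congr rfl hz
    rw [Finset.sum_sub_distrib, hq, Finset.sum_const, nsmul_eq_mul] at h1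
    have h2 : (S.card : ℝ) ≠ 0 := by exact_mod_cast hcard.ne'
    push_cast
    rw [eq_div_iff h2, ← h1]; ring
  have hlint : IsIntegral ℤ l := by
    refine ⟨A.charpoly, A.charpoly_monic, ?_⟩
    have h1 : M.charpoly = A.charpoly.map (Int.castRingHom ℝ) := by
      simpa [hMdef] using Matrix.charpoly_map A (Int.castRingHom ℝ)
    have h2 := dotProduct_aeval_mulVec hMs hx M.charpoly U
    rw [Matrix.aeval_self_charpoly, Matrix.zero_mulVec, dotProduct_zero] at h2
    have h3 := (mul_eq_zero.1 h2.symm).resolve_right hxu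
    rwa [h1, Polynomial.eval_map] at h3
  rw [hlq, ← eq_ratCast (algebraMap ℚ ℝ),
    isIntegral_algebraMap_iff (algebraMap ℚ ℝ).injective] at hlint
  obtain ⟨y, hy⟩ := IsIntegrallyClosed.isIntegral_iff.1 hlint
  refine ⟨y, ?_⟩
  rw [hlq, ← hy]
  simp

/-! ### Transition matrices and eigenvectors -/

theorem exp_mulVec_of_eigenvector {V : Type*} [Fintype V] [DecidableEq V] {M : Matrix V V ℂ}
    {y : V → ℂ} {θ : ℂ} (h : M *ᵥ y = θ • y) :
    NormedSpace.exp M *ᵥ y = Complex.exp θ • y := by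
  let _ : NormedRing (Matrix V V ℂ) := Matrix.linftyOpNormedRing
  let _ : NormedAlgebra ℂ (Matrix V V ℂ) := Matrix.linftyOpNormedAlgebra
  have h1 : HasSum (fun n : ℕ => ((n.factorial : ℂ)⁻¹ • M ^ n)) (NormedSpace.exp M) :=
    NormedSpace.exp_series_hasSum_exp' M
  have h2 : HasSum (fun n : ℕ => ((n.factorial : ℂ)⁻¹ • M ^ n) *ᵥ y) (NormedSpace.exp M *ᵥ y) :=
    h1.map (⟨⟨fun N : Matrix V V ℂ => N *ᵥ y, Matrix.zero_mulVec y⟩,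
      fun A B => Matrix.add_mulVec A B y⟩ : Matrix V V ℂ →+ (V → ℂ))
      (continuous_id.matrix_mulVec continuous_const)
  have h3 : HasSum (fun n : ℕ => ((n.factorial : ℂ)⁻¹ • θ ^ n)) (Complex.exp θ) := by
    rw [Complex.exp_eq_exp_ℂ]
    exact NormedSpace.exp_series_hasSum_exp' θ
  have h4 := h3.smul_const y
  refine h2.unique (h4.congr_fun fun n => ?_)
  have := aeval_mulVec_of_eigenvector h (Polynomial.X ^ n)
  simp only [map_pow, Polynomial.aeval_X, Polynomial.eval_pow, Polynomial.eval_X] at this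
  rw [Matrix.smul_mulVec, this, smul_assoc]

section

variable {V : Type*} [Fintype V] [DecidableEq V] (G : SimpleGraph V) [DecidableRel G.Adj]

theorem transitionMatrix_mulVec_of_eigenvector {y : V → ℂ} {θ : ℂ}
    (h : G.lapMatrix ℂ *ᵥ y = θ • y) (t : ℝ) :
    transitionMatrix G t *ᵥ y = Complex.exp (-Complex.I * t * θ) • y :=
  exp_mulVec_of_eigenvector (by rw [Matrix.smul_mulVec, h, smul_smul])

theorem transitionMatrix_isSymm (t : ℝ) : (transitionMatrix G t).IsSymm :=
  Matrix.IsSymm.exp ((G.isSymm_lapMatrix ℂ).smul _)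

theorem lapMatrix_int_map : (G.lapMatrix ℤ).map (Int.cast : ℤ → ℝ) = G.lapMatrix ℝ := by
  ext i j
  simp [SimpleGraph.lapMatrix, SimpleGraph.degMatrix, Matrix.diagonal_apply,
    SimpleGraph.adjMatrix_apply, apply_ite (Int.cast : ℤ → ℝ)]

theorem lapMatrix_mulVec_ofReal {x : V → ℝ} {l : ℝ} (hx : G.lapMatrix ℝ *ᵥ x = l • x) :
    G.lapMatrix ℂ *ᵥ (fun v => (x v : ℂ)) = (l : ℂ) • fun v => (x v : ℂ) := by
  funext v
  have h := congrArg (Complex.ofReal) (congrFun hx v)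
  rw [SimpleGraph.lapMatrix_mulVec_apply] at h ⊢
  simpa using h

variable {G}

theorem dotProduct_transitionMatrix_mulVec {x : V → ℝ} {l : ℝ} (hx : G.lapMatrix ℝ *ᵥ x = l • x)
    (t : ℝ) (w : V → ℂ) :
    (fun v => (x v : ℂ)) ⬝ᵥ (transitionMatrix G t *ᵥ w) =
      Complex.exp (-Complex.I * t * l) * ((fun v => (x v : ℂ)) ⬝ᵥ w) := by
  rw [Matrix.dotProduct_mulVec, ← Matrix.mulVec_transpose, (transitionMatrix_isSymm G t).eq,
    transitionMatrix_mulVec_of_eigenvector G (lapMatrix_mulVec_ofReal G hx), smul_dotProduct,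
    smul_eq_mul]

theorem dotProduct_pairState (x : V → ℂ) (a b : V) : x ⬝ᵥ pairState a b = x a - x b := by
  simp [pairState]

/-- Under perfect transfer at time `π / g`, eigenvalues in the support of the initial pair state
differ by multiples of `g`: the quotient of their phases is real. -/
theorem exists_int_mul_eq_sub_of_hasPairLPSTAt {a b c d : V} {g : ℕ} (hg : 0 < g)
    (h : HasPairLPSTAt G a b c d (Real.pi / (g : ℝ))) {x x' : V → ℝ} {l l' : ℝ}
    (hx : G.lapMatrix ℝ *ᵥ x = l • x) (hx' : G.lapMatrix ℝ *ᵥ x' = l' • x')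
    (hab : x a - x b ≠ 0) (hab' : x' a - x' b ≠ 0) : ∃ z : ℤ, l - l' = g * z := by
  obtain ⟨-, -, -, χ, hχ, hU⟩ := h
  set τ : ℝ := Real.pi / (g : ℝ) with hτ
  have key : ∀ {x : V → ℝ} {l : ℝ}, G.lapMatrix ℝ *ᵥ x = l • x →
      Complex.exp (-Complex.I * τ * l) * ((x a - x b : ℝ) : ℂ) = χ * ((x c - x d : ℝ) : ℂ) := by
    intro x l hx
    have h1 := dotProduct_transitionMatrix_mulVec hx τ (pairState a b)
    rw [hU, dotProduct_smul, dotProduct_pairState, dotProduct_pairState, smul_eq_mul] at h1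
    push_cast
    exact h1.symm
  have k1 := key hx
  have k2 := key hx'
  have hcd' : x' c - x' d ≠ 0 := by
    intro h0
    rw [h0, Complex.ofReal_zero, mul_zero, mul_eq_zero] at k2
    rcases k2 with k2 | k2
    · exact Complex.exp_ne_zero _ k2
    · exact hab' (by exact_mod_cast k2)
  have h3 : Complex.exp ((-(τ * (l - l')) : ℝ) * Complex.I) *
      (((x a - x b) * (x' c - x' d) : ℝ) : ℂ) = (((x' a - x' b) * (x c - x d) : ℝ) : ℂ) := by
    have h4 : Complex.exp ((-(τ * (l - l')) : ℝ) * Complex.I) *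
        Complex.exp (-Complex.I * τ * l') = Complex.exp (-Complex.I * τ * l) := by
      rw [← Complex.exp_add]; congr 1; push_cast; ring
    have hχ0 : χ ≠ 0 := by rintro rfl; simp at hχ
    refine mul_left_cancel₀ (mul_ne_zero (Complex.exp_ne_zero (-Complex.I * τ * l')) hχ0) ?_
    push_cast at k1 k2 h4 ⊢
    linear_combination (χ * ((x a : ℂ) - x b) * (x' c - x' d)) * h4 +
      (χ * ((x' c : ℂ) - x' d)) * k1 - (χ * ((x c : ℂ) - x d)) * k2
  have h5 := congrArg Complex.im h3
  rw [Complex.im_mul_ofReal, Complex.exp_ofReal_mul_I_im, Complex.ofReal_im, mul_eq_zero,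
    Real.sin_neg, neg_eq_zero] at h5
  obtain ⟨n, hn⟩ := Real.sin_eq_zero_iff.1 (h5.resolve_right (mul_ne_zero hab hcd'))
  refine ⟨n, ?_⟩
  have hg0 : (g : ℝ) ≠ 0 := by exact_mod_cast hg.ne'
  rw [hτ] at hn
  field_simp at hn
  linarith

theorem exists_int_eq_of_hasPairLPSTAt {a b c d : V} {g : ℕ} (hg : 0 < g)
    (h : HasPairLPSTAt G a b c d (Real.pi / (g : ℝ))) {x : V → ℝ} {l : ℝ}
    (hx : G.lapMatrix ℝ *ᵥ x = l • x) (hab : x a - x b ≠ 0) : ∃ z : ℤ, l = z := by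
  have hdot : ∀ y : V → ℝ,
      y ⬝ᵥ (fun v => (((Pi.single a 1 - Pi.single b 1 : V → ℤ) v : ℤ) : ℝ)) = y a - y b := by
    intro y
    simp [dotProduct, Pi.single_apply, mul_sub, Finset.sum_sub_distrib]
  refine exists_int_eq_of_eigenvalue_differences (G.lapMatrix ℤ) (G.isSymm_lapMatrix ℤ)
    (Pi.single a 1 - Pi.single b 1) ?_ l x (by rwa [lapMatrix_int_map]) (by rwa [hdot])
  intro l l' x x' hx hx' hu hu'
  rw [lapMatrix_int_map] at hx hx'
  rw [hdot] at hu hu'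
  obtain ⟨z, hz⟩ := exists_int_mul_eq_sub_of_hasPairLPSTAt hg h hx hx' hu hu'
  exact ⟨g * z, by rw [hz]; push_cast; ring⟩

end

/-! ### Laplacian eigenvectors of the Q-graph -/

/-- The sum of the values of `x` at the two ends of an edge: the transpose of the incidence matrix
applied to `x`. -/
def edgeSum {V : Type*} (x : V → ℂ) : Sym2 V → ℂ :=
  Sym2.lift ⟨fun u v => x u + x v, fun _ _ => add_comm _ _⟩

@[simp]
theorem edgeSum_mk {V : Type*} (x : V → ℂ) (u v : V) : edgeSum x s(u, v) = x u + x v := rfl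

theorem lineGraph_adj_mk_iff {V : Type*} {G : SimpleGraph V} {a b : V} (h : s(a, b) ∈ G.edgeSet)
    (f : G.edgeSet) :
    G.lineGraph.Adj ⟨s(a, b), h⟩ f ↔
      s(a, b) ≠ (f : Sym2 V) ∧ (a ∈ (f : Sym2 V) ∨ b ∈ (f : Sym2 V)) := by
  rw [SimpleGraph.lineGraph_adj_iff_exists]
  constructor
  · rintro ⟨hne, v, hv, hvf⟩
    refine ⟨fun h => hne (Subtype.ext h), ?_⟩
    rcases Sym2.mem_iff.1 hv with rfl | rfl
    · exact Or.inl hvf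
    · exact Or.inr hvf
  · rintro ⟨hne, hv⟩
    refine ⟨fun h => hne (congrArg Subtype.val h), ?_⟩
    rcases hv with hv | hv
    · exact ⟨a, by simp, hv⟩
    · exact ⟨b, by simp, hv⟩

theorem eq_of_connected_of_forall_adj {V α : Type*} {G : SimpleGraph V}
    (hconn : G.Connected) {f : V → α}
    (hf : ∀ u v, G.Adj u v → f u = f v) (u v : V) : f u = f v := by
  obtain ⟨p⟩ := hconn.preconnected u v
  induction p with
  | nil => rfl
  | cons h _ ih => exact (hf _ _ h).trans ih

section

variable {V : Type*} [Fintype V] [DecidableEq V] {G : SimpleGraph V} [DecidableRel G.Adj]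

theorem lapMatrix_mulVec_eq_sum_ite {W : Type*} [Fintype W] [DecidableEq W] (H : SimpleGraph W)
    [DecidableRel H.Adj] (y : W → ℂ) (v : W) :
    (H.lapMatrix ℂ *ᵥ y) v = ∑ w, if H.Adj v w then y v - y w else 0 := by
  rw [SimpleGraph.lapMatrix_mulVec_apply, ← Finset.sum_filter, Finset.sum_sub_distrib,
    Finset.sum_const, nsmul_eq_mul, ← SimpleGraph.card_neighborFinset_eq_degree,
    SimpleGraph.neighborFinset_eq_filter]

theorem sum_edgeSet_ite_mem (F : Sym2 V → ℂ) (v : V) :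
    (∑ e : G.edgeSet, if v ∈ (e : Sym2 V) then F e else 0) =
      ∑ w ∈ G.neighborFinset v, F s(v, w) := by
  have h1 : (∑ e : G.edgeSet, if v ∈ (e : Sym2 V) then F e else 0) =
      ∑ e ∈ G.edgeFinset, if v ∈ e then F e else 0 :=
    (Finset.sum_subtype G.edgeFinset (fun e => SimpleGraph.mem_edgeFinset)
      (fun e => if v ∈ e then F e else 0)).symm
  rw [h1, ← Finset.sum_filter]
  symm
  refine Finset.sum_nbij (fun w => s(v, w)) ?_ ?_ ?_ fun _ _ => rfl
  · intro w hw
    simpa using hw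
  · intro w _ w' _ h
    exact Sym2.congr_right.1 h
  · intro e he
    simp only [Finset.coe_filter, SimpleGraph.mem_edgeFinset, Set.mem_ofPred_eq] at he
    obtain ⟨w, rfl⟩ := he.2
    exact ⟨w, by simpa using he.1, rfl⟩

/-- The extension of a vector `x` on the vertices of `G` to the Q-graph by `s` times its edge
sums. -/
def qLift (G : SimpleGraph V) (x : V → ℂ) (s : ℂ) : V ⊕ G.edgeSet → ℂ :=
  Sum.elim x fun e => s * edgeSum x e

theorem sum_neighborFinset_of_eigenvector {r : ℕ} (hreg : G.IsRegularOfDegree r) {x : V → ℂ}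
    {l : ℂ} (hx : G.lapMatrix ℂ *ᵥ x = l • x) (v : V) :
    ∑ w ∈ G.neighborFinset v, x w = (r - l) * x v := by
  have h := congrFun hx v
  rw [SimpleGraph.lapMatrix_mulVec_apply, hreg v, Pi.smul_apply, smul_eq_mul] at h
  linear_combination -h

/-- The equation `h2` at the edges keeps the factor `edgeSum x e` so that it also covers the eigenvalue
`l = 2 * r`, for which all edge sums vanish. -/
theorem lapMatrix_qGraph_mulVec_qLift {r : ℕ} (hreg : G.IsRegularOfDegree r) {x : V → ℂ} {l : ℂ}
    (hx : G.lapMatrix ℂ *ᵥ x = l • x) {s θ : ℂ} (h1 : r - s * (2 * r - l) = θ)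
    (h2 : ∀ e ∈ G.edgeSet, (s * (2 + l) - 1) * edgeSum x e = θ * s * edgeSum x e) :
    (qGraph G).lapMatrix ℂ *ᵥ qLift G x s = θ • qLift G x s := by
  have hN := sum_neighborFinset_of_eigenvector hreg hx
  have hcard : ∀ v, ((G.neighborFinset v).card : ℂ) = r := fun v => by
    rw [SimpleGraph.card_neighborFinset_eq_degree, hreg v]
  funext y
  rw [lapMatrix_mulVec_eq_sum_ite, Fintype.sum_sum_type]
  rcases y with v | ⟨e, he⟩
  · have hA : ∀ w : V, ¬ (qGraph G).Adj (Sum.inl v) (Sum.inl w) := fun w => id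
    have hB : ∀ e : G.edgeSet, (qGraph G).Adj (Sum.inl v) (Sum.inr e) ↔ v ∈ (e : Sym2 V) :=
      fun e => Iff.rfl
    simp only [hA, hB, if_false, Finset.sum_const_zero, zero_add, qLift, Sum.elim_inl,
      Sum.elim_inr, Pi.smul_apply, smul_eq_mul]
    rw [sum_edgeSet_ite_mem (fun e => x v - s * edgeSum x e) v]
    simp only [edgeSum_mk]
    rw [Finset.sum_sub_distrib, ← Finset.mul_sum, Finset.sum_add_distrib, hN, Finset.sum_const,
      nsmul_eq_mul, hcard, ← h1]
    ring
  · induction e using Sym2.ind with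
    | _ a b =>
      have hab : G.Adj a b := he
      have hA : ∀ w : V, (qGraph G).Adj (Sum.inr ⟨s(a, b), he⟩) (Sum.inl w) ↔ w = a ∨ w = b :=
        fun w => Sym2.mem_iff
      have hB : ∀ f : G.edgeSet, (qGraph G).Adj (Sum.inr ⟨s(a, b), he⟩) (Sum.inr f) ↔
          G.lineGraph.Adj ⟨s(a, b), he⟩ f := fun f => Iff.rfl
      have hsplit : ∀ f : G.edgeSet, (if s(a, b) ≠ (f : Sym2 V) ∧
          (a ∈ (f : Sym2 V) ∨ b ∈ (f : Sym2 V)) then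
            s * edgeSum x s(a, b) - s * edgeSum x f else 0) =
          (if a ∈ (f : Sym2 V) then s * edgeSum x s(a, b) - s * edgeSum x f else 0) +
          (if b ∈ (f : Sym2 V) then s * edgeSum x s(a, b) - s * edgeSum x f else 0) := by
        intro f
        by_cases hf : s(a, b) = (f : Sym2 V)
        · simp [← hf]
        · have hnot : ¬ (a ∈ (f : Sym2 V) ∧ b ∈ (f : Sym2 V)) := fun h =>
            hf ((Sym2.mem_and_mem_iff hab.ne).1 h).symm
          by_cases ha : a ∈ (f : Sym2 V) <;> by_cases hb : b ∈ (f : Sym2 V) <;> simp_all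
      have hfst : (∑ w : V, if w = a ∨ w = b then s * edgeSum x s(a, b) - x w else 0) =
          (s * edgeSum x s(a, b) - x a) + (s * edgeSum x s(a, b) - x b) := by
        rw [← Finset.sum_filter,
          ← Finset.sum_pair (f := fun w => s * edgeSum x s(a, b) - x w) hab.ne]
        refine Finset.sum_congr ?_ fun _ _ => rfl
        ext w; simp
      have h3 := h2 _ he
      simp only [hA, hB, lineGraph_adj_mk_iff, qLift, Sum.elim_inl, Sum.elim_inr, Pi.smul_apply,
        smul_eq_mul, hsplit, hfst]
      rw [Finset.sum_add_distrib,
        sum_edgeSet_ite_mem (fun f => s * edgeSum x s(a, b) - s * edgeSum x f) a,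
        sum_edgeSet_ite_mem (fun f => s * edgeSum x s(a, b) - s * edgeSum x f) b]
      simp only [edgeSum_mk, Finset.sum_sub_distrib, ← Finset.mul_sum, Finset.sum_add_distrib, hN,
        Finset.sum_const, nsmul_eq_mul, hcard] at h3 ⊢
      linear_combination h3

/-- An eigenvector for an eigenvalue `l ≠ 2 * r`, extended by zero, is a combination of two
eigenvectors of the Q-graph, whose eigenvalues are the roots of
`θ ^ 2 - (r + 2 + l) * θ + (r + 1) * l`. -/
theorem exists_transitionMatrix_qGraph_apply {r : ℕ} (hreg : G.IsRegularOfDegree r) {x : V → ℂ}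
    {l D : ℂ} (hx : G.lapMatrix ℂ *ᵥ x = l • x) (hl : l ≠ 2 * r) (hD : D ≠ 0)
    (hDl : D ^ 2 = (r - l) ^ 2 + 4 * (r + 1)) :
    ∃ p q : ℂ, p + q = 1 ∧ ∀ (t : ℝ) (v : V),
      (transitionMatrix (qGraph G) t *ᵥ Sum.elim x 0) (Sum.inl v) =
        (p * Complex.exp (-Complex.I * t * ((r + 2 + l + D) / 2)) +
          q * Complex.exp (-Complex.I * t * ((r + 2 + l - D) / 2))) * x v := by
  have hl' : 2 * (r : ℂ) - l ≠ 0 := sub_ne_zero.2 hl.symm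
  set s₁ : ℂ := (r - (r + 2 + l + D) / 2) / (2 * r - l) with hs₁
  set s₂ : ℂ := (r - (r + 2 + l - D) / 2) / (2 * r - l) with hs₂
  have hs : s₁ - s₂ = -D / (2 * r - l) := by rw [hs₁, hs₂]; field_simp; ring
  have hs0 : s₁ - s₂ ≠ 0 := by rw [hs]; exact div_ne_zero (neg_ne_zero.2 hD) hl'
  have hE₁ : s₁ * (2 * r - l) = r - (r + 2 + l + D) / 2 := div_mul_cancel₀ _ hl'
  have hE₂ : s₂ * (2 * r - l) = r - (r + 2 + l - D) / 2 := div_mul_cancel₀ _ hl'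
  have e₁ := lapMatrix_qGraph_mulVec_qLift hreg hx (s := s₁) (θ := (r + 2 + l + D) / 2)
    (by linear_combination -hE₁)
    (fun e _ => by
      congr 1
      refine mul_right_cancel₀ hl' ?_
      linear_combination (2 + l - (r + 2 + l + D) / 2) * hE₁ + (1 / 4) * hDl)
  have e₂ := lapMatrix_qGraph_mulVec_qLift hreg hx (s := s₂) (θ := (r + 2 + l - D) / 2)
    (by linear_combination -hE₂)
    (fun e _ => by
      congr 1
      refine mul_right_cancel₀ hl' ?_
      linear_combination (2 + l - (r + 2 + l - D) / 2) * hE₂ + (1 / 4) * hDl)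
  refine ⟨-s₂ / (s₁ - s₂), s₁ / (s₁ - s₂), by field_simp; ring, fun t v => ?_⟩
  have hdec : (Sum.elim x 0 : V ⊕ G.edgeSet → ℂ) =
      (-s₂ / (s₁ - s₂)) • qLift G x s₁ + (s₁ / (s₁ - s₂)) • qLift G x s₂ := by
    funext y
    rcases y with v | e
    · simp only [qLift, Sum.elim_inl, Pi.add_apply, Pi.smul_apply, smul_eq_mul]
      field_simp; ring
    · simp only [qLift, Sum.elim_inr, Pi.add_apply, Pi.smul_apply, smul_eq_mul, Pi.zero_apply]
      field_simp; ring
  rw [hdec, Matrix.mulVec_add, Matrix.mulVec_smul, Matrix.mulVec_smul,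
    transitionMatrix_mulVec_of_eigenvector _ e₁, transitionMatrix_mulVec_of_eigenvector _ e₂]
  simp only [qLift, Sum.elim_inl, Pi.add_apply, Pi.smul_apply, smul_eq_mul]
  ring

/-! ### Eigenvectors for the extreme eigenvalues -/

/-- An eigenvector for the eigenvalue `2 * r` changes sign along every edge, because it is killed by
the signless Laplacian. -/
theorem eq_neg_of_adj_of_eigenvector {r : ℕ} (hreg : G.IsRegularOfDegree r) {x : V → ℝ}
    (hx : G.lapMatrix ℝ *ᵥ x = (2 * r : ℝ) • x) {u v : V} (huv : G.Adj u v) : x u = -x v := by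
  have hN : ∀ v, ∑ w ∈ G.neighborFinset v, x w = -(r * x v) := by
    intro v
    have h := congrFun hx v
    rw [SimpleGraph.lapMatrix_mulVec_apply, hreg v, Pi.smul_apply, smul_eq_mul] at h
    linarith
  have hswap : ∑ v, ∑ w ∈ G.neighborFinset v, x w ^ 2 = ∑ v, ∑ w ∈ G.neighborFinset v, x v ^ 2 := by
    simp only [SimpleGraph.neighborFinset_eq_filter, Finset.sum_filter]
    rw [Finset.sum_comm]
    simp only [SimpleGraph.adj_comm]
  have hzero : ∑ v, ∑ w ∈ G.neighborFinset v, (x v + x w) ^ 2 = 0 := by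
    have h1 : ∀ v, ∑ w ∈ G.neighborFinset v, (x v + x w) ^ 2 =
        ∑ w ∈ G.neighborFinset v, x v ^ 2 + 2 * x v * ∑ w ∈ G.neighborFinset v, x w +
          ∑ w ∈ G.neighborFinset v, x w ^ 2 := by
      intro v
      rw [Finset.mul_sum, ← Finset.sum_add_distrib, ← Finset.sum_add_distrib]
      exact Finset.sum_congr rfl fun w _ => by ring
    simp only [h1, Finset.sum_add_distrib, hswap, hN]
    simp only [Finset.sum_const, SimpleGraph.card_neighborFinset_eq_degree, hreg.degree_eq,
      nsmul_eq_mul]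
    rw [← Finset.sum_add_distrib, ← Finset.sum_add_distrib]
    exact Finset.sum_eq_zero fun v _ => by ring
  have h1 := (Finset.sum_eq_zero_iff_of_nonneg
    (fun v _ => Finset.sum_nonneg fun w _ => sq_nonneg (x v + x w))).1 hzero u (Finset.mem_univ u)
  have h2 := (Finset.sum_eq_zero_iff_of_nonneg (fun w _ => sq_nonneg (x u + x w))).1 h1 v
    (by simpa using huv)
  have h3 := pow_eq_zero_iff two_ne_zero |>.1 h2
  linarith

theorem eq_zero_of_eigenvector_of_not_isBipartite (hconn : G.Connected) {r : ℕ}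
    (hreg : G.IsRegularOfDegree r) (hG : ¬ G.IsBipartite) {x : V → ℝ}
    (hx : G.lapMatrix ℝ *ᵥ x = (2 * r : ℝ) • x) (v : V) : x v = 0 := by
  by_contra hv
  have hsq := eq_of_connected_of_forall_adj hconn (f := fun v => x v ^ 2) fun u w huw => by
    rw [eq_neg_of_adj_of_eigenvector hreg hx huw, neg_sq]
  have hne : ∀ w, x w ≠ 0 := fun w hw => hv (by have := hsq v w; simpa [hw] using this)
  refine hG ⟨SimpleGraph.Coloring.mk (fun w => if 0 < x w then (0 : Fin 2) else 1) ?_⟩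
  intro u w huw
  have h1 := eq_neg_of_adj_of_eigenvector hreg hx huw
  rcases (hne w).lt_or_gt with h | h
  · rw [if_pos (by linarith), if_neg (by linarith)]; decide
  · rw [if_neg (by linarith), if_pos h]; decide

theorem eq_of_eigenvector_of_same_part (hconn : G.Connected) {r : ℕ}
    (hreg : G.IsRegularOfDegree r) {V₁ V₂ : Set V} (hG : G.IsBipartiteWith V₁ V₂) {x : V → ℝ}
    (hx : G.lapMatrix ℝ *ᵥ x = (2 * r : ℝ) • x) {a b : V}
    (hab : a ∈ V₁ ∧ b ∈ V₁ ∨ a ∈ V₂ ∧ b ∈ V₂) : x a = x b := by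
  classical
  have hdis : ∀ w, w ∈ V₂ → w ∉ V₁ := fun w h2 h1 => Set.disjoint_left.1 hG.disjoint h1 h2
  have h := eq_of_connected_of_forall_adj hconn (f := fun v => if v ∈ V₁ then x v else -x v)
    (fun u w huw => by
      have h1 := eq_neg_of_adj_of_eigenvector hreg hx huw
      rcases hG.mem_of_adj huw with ⟨hu, hw⟩ | ⟨hu, hw⟩
      · simp [hu, hdis w hw, h1]
      · simp [hw, hdis u hu, h1]) a b
  rcases hab with ⟨ha, hb⟩ | ⟨ha, hb⟩
  · simpa [ha, hb] using h
  · simpa [hdis a ha, hdis b hb] using h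

/-- For `r + 1` prime, `(r - z) ^ 2 + 4 * (r + 1)` is a square only for `z = 0` and `z = 2 * r`:
the factors of `4 * (r + 1) = (k - |r - z|) * (k + |r - z|)` have equal parity, so they are `2` and
`2 * (r + 1)`. -/
theorem eq_zero_or_eq_two_mul_of_isSquare {r d : ℕ} (hr : (r + 1).Prime) {z : ℤ}
    (hd : (d : ℤ) = (r - z) ^ 2 + 4 * (r + 1)) (hsq : IsSquare d) : z = 0 ∨ z = 2 * r := by
  obtain ⟨k, rfl⟩ := hsq
  obtain ⟨m, hm⟩ : ∃ m : ℕ, (m : ℤ) = |(r : ℤ) - z| := ⟨_, Int.natCast_natAbs _⟩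
  have hkm : k * k = m * m + 4 * (r + 1) := by
    have : (m : ℤ) ^ 2 = (r - z) ^ 2 := by rw [hm, sq_abs]
    zify
    push_cast at hd
    linarith
  have hlt : m < k := by nlinarith
  obtain ⟨j, rfl⟩ := Nat.exists_eq_add_of_lt hlt
  have hj : (j + 1) * (2 * m + (j + 1)) = 4 * (r + 1) := by nlinarith
  obtain ⟨i, hi⟩ : 2 ∣ j + 1 := by
    by_contra hodd
    have h1 : Odd (j + 1) := Nat.not_even_iff_odd.1 fun h => hodd h.two_dvd
    have h2 : Odd ((j + 1) * (2 * m + (j + 1))) := h1.mul ((even_two_mul m).add_odd h1)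
    rw [hj] at h2
    exact (Nat.not_even_iff_odd.2 h2) ⟨2 * (r + 1), by ring⟩
  rw [hi] at hj
  have hij : i * (m + i) = r + 1 := by nlinarith
  have hrm : m = r := by
    rcases (Nat.dvd_prime hr).1 ⟨m + i, hij.symm⟩ with h | h
    · subst h; omega
    · rw [h] at hij
      have : m + (r + 1) = 1 := Nat.eq_of_mul_eq_mul_left (Nat.succ_pos r) (by rw [hij, mul_one])
      omega
  rcases abs_choice ((r : ℤ) - z) with h | h <;> rw [h] at hm <;> [left; right] <;> omega

end

/-! ### Pretty good transfer in the Q-graph -/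

theorem sum_eigenvectorBasis_dotProduct_mul {V : Type*} [Fintype V] [DecidableEq V]
    {M : Matrix V V ℝ} (hM : M.IsHermitian) (f : V → ℝ) (v : V) :
    ∑ i, ((hM.eigenvectorBasis i).ofLp ⬝ᵥ f) * (hM.eigenvectorBasis i).ofLp v = f v := by
  have h := congrArg (fun y : EuclideanSpace ℝ V => y.ofLp v)
    (hM.eigenvectorBasis.sum_repr (WithLp.toLp 2 f))
  simp only [WithLp.ofLp_sum, WithLp.ofLp_smul, Finset.sum_apply, Pi.smul_apply, smul_eq_mul] at h
  rw [← h]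
  refine Finset.sum_congr rfl fun i _ => ?_
  rw [OrthonormalBasis.repr_apply_apply, EuclideanSpace.inner_eq_star_dotProduct, star_trivial,
    dotProduct_comm]

theorem pairState_inl {V W : Type*} [DecidableEq V] [DecidableEq W] (a b : V) :
    pairState (Sum.inl a : V ⊕ W) (Sum.inl b) = Sum.elim (pairState a b) 0 := by
  funext y
  rcases y with v | w <;> simp [pairState, Pi.single_apply]

section

variable {V : Type*} [Fintype V] [DecidableEq V] {G : SimpleGraph V} [DecidableRel G.Adj]

/-- The times `τ = 2π/g + 4πm` turn the factors `exp(-iτl/2)` of integral eigenvalues `l` into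
`exp(-iπl/g)`, and for suitable `m` the factors `exp(±iτ√D/2)` are close to `1`. Along these times, up
to a common phase, the Q-graph moves the pair state as `G` does at time `π / g`. The eigenvalue
`2 * r` of `G` is special, because its discriminant is a square: either it lies outside the support of
the pair state, or `2 * g ∣ r + 2` brings its phase in step with the others. -/
theorem hasPairLPGST_qGraph (hconn : G.Connected) {r : ℕ} (hreg : G.IsRegularOfDegree r)
    (hr : (r + 1).Prime) {a b c d : V} {g : ℕ} (hg : 0 < g)
    (hpst : HasPairLPSTAt G a b c d (Real.pi / (g : ℝ)))
    (h2r : (∀ x : V → ℝ, G.lapMatrix ℝ *ᵥ x = (2 * r : ℝ) • x → x a = x b) ∨ 2 * g ∣ r + 2) :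
    HasPairLPGST (qGraph G) (Sum.inl a) (Sum.inl b) (Sum.inl c) (Sum.inl d) := by
  have hM : (G.lapMatrix ℝ).IsHermitian := SimpleGraph.isHermitian_lapMatrix ℝ G
  obtain ⟨e, he⟩ : ∃ e : V → V → ℝ, e = fun i => (hM.eigenvectorBasis i).ofLp := ⟨_, rfl⟩
  obtain ⟨l, hl⟩ : ∃ l : V → ℝ, l = hM.eigenvalues := ⟨_, rfl⟩
  have hel : ∀ i, G.lapMatrix ℝ *ᵥ e i = l i • e i := fun i => by
    rw [he, hl]; exact hM.mulVec_eigenvectorBasis i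
  have helC := fun i => lapMatrix_mulVec_ofReal G (hel i)
  have hg0 : (g : ℂ) ≠ 0 := by exact_mod_cast hg.ne'
  have hdec : (pairState a b : V → ℂ) =
      ∑ i, ((e i a - e i b : ℝ) : ℂ) • fun v => (e i v : ℂ) := by
    funext v
    have h1 := sum_eigenvectorBasis_dotProduct_mul hM (Pi.single a 1 - Pi.single b 1) v
    simp only [dotProduct_sub, dotProduct_single, mul_one] at h1
    have h2 : pairState a b v = (((Pi.single a 1 - Pi.single b 1 : V → ℝ) v : ℝ) : ℂ) := by
      simp [pairState, Pi.single_apply, apply_ite (Complex.ofReal)]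
    rw [h2, ← h1, he]
    simp
  -- The spectral data of the support.
  have hint : ∀ i, e i a - e i b ≠ 0 → ∃ z : ℤ, l i = z := fun i hi =>
    exists_int_eq_of_hasPairLPSTAt hg hpst (hel i) hi
  choose! z hz using hint
  let D : V → ℕ := fun i => ((r - z i) ^ 2 + 4 * (r + 1)).toNat
  have hDz : ∀ i, (D i : ℤ) = (r - z i) ^ 2 + 4 * (r + 1) := fun i =>
    Int.toNat_of_nonneg (by positivity)
  let J := {i : V // e i a - e i b ≠ 0 ∧ l i ≠ 2 * r}
  have hDsq : ∀ j : J, ¬ IsSquare (D j.1) := by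
    rintro ⟨i, hi, hi2⟩ hsq
    rcases eq_zero_or_eq_two_mul_of_isSquare hr (hDz i) hsq with h | h
    · have h1 := hel i
      rw [hz i hi, h, Int.cast_zero, zero_smul,
        SimpleGraph.lapMatrix_mulVec_eq_zero_iff_forall_reachable] at h1
      exact hi (sub_eq_zero.2 (h1 a b (hconn.preconnected a b)))
    · exact hi2 (by rw [hz i hi, h]; push_cast; ring)
  obtain ⟨m, hm⟩ := exists_seq_tendsto_exp_sqrt (fun j : J => D j.1) hDsq (1 / (2 * g))
  let τ : ℕ → ℝ := fun n => 4 * Real.pi * (1 / (2 * g) + m n)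
  have hτint : ∀ (n : ℕ) (y : ℤ), Complex.exp (-Complex.I * τ n * (y / 2)) =
      Complex.exp (-Complex.I * (Real.pi / g : ℝ) * y) := by
    intro n y
    rw [Complex.exp_eq_exp_iff_exists_int]
    refine ⟨-(m n * y), ?_⟩
    simp only [τ]
    push_cast
    field_simp
    ring
  have hcoef : ∀ i, ∃ f : ℝ → ℂ,
      (∀ t v, (transitionMatrix (qGraph G) t *ᵥ Sum.elim (fun v => (e i v : ℂ)) 0) (Sum.inl v) =
        f t * e i v) ∧
      (e i a - e i b ≠ 0 → Tendsto
        (fun n => Complex.exp (Complex.I * τ n * ((r + 2 : ℂ) / 2)) * f (τ n)) atTop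
        (𝓝 (Complex.exp (-Complex.I * (Real.pi / g : ℝ) * l i)))) := by
    intro i
    by_cases hi2 : l i = 2 * r
    · -- Extended by zero, the vector is itself an eigenvector, for the eigenvalue `r`.
      have hlift : qLift G (fun v => (e i v : ℂ)) 0 = Sum.elim (fun v => (e i v : ℂ)) 0 := by
        funext y
        rcases y with v | f <;> simp [qLift]
      have heig := lapMatrix_qGraph_mulVec_qLift hreg (helC i) (s := 0) (θ := r) (by ring) (by
        intro f hf
        induction f using Sym2.ind with
        | _ u v =>
          have h1 := eq_neg_of_adj_of_eigenvector hreg (by rw [← hi2]; exact hel i)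
            ((SimpleGraph.mem_edgeSet G).1 hf)
          simp [h1])
      rw [hlift] at heig
      refine ⟨fun t => Complex.exp (-Complex.I * t * r), fun t v => ?_, fun hi => ?_⟩
      · rw [transitionMatrix_mulVec_of_eigenvector _ heig]
        simp
      · have hdvd : 2 * g ∣ r + 2 := h2r.resolve_left fun h =>
          hi (sub_eq_zero.2 (h (e i) (by rw [← hi2]; exact hel i)))
        obtain ⟨k, hk⟩ := hdvd
        have hkC : (r : ℂ) + 2 = 2 * g * k := by exact_mod_cast hk
        refine tendsto_const_nhds.congr fun n => ?_
        rw [← Complex.exp_add, hi2, Complex.exp_eq_exp_iff_exists_int]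
        refine ⟨m n * (2 * r - (r + 2)) - k, ?_⟩
        simp only [τ]
        push_cast
        field_simp
        linear_combination (-4 : ℂ) * hkC
    · have hne : (l i : ℂ) ≠ 2 * r := by exact_mod_cast hi2
      by_cases hi : e i a - e i b = 0
      · have hpos : 0 < (r - l i) ^ 2 + 4 * ((r : ℝ) + 1) := by positivity
        obtain ⟨p, q, -, hpq⟩ := exists_transitionMatrix_qGraph_apply hreg (helC i) hne
          (D := (√((r - l i) ^ 2 + 4 * ((r : ℝ) + 1)) : ℝ))
          (by exact_mod_cast (Real.sqrt_pos.2 hpos).ne')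
          (by rw [← Complex.ofReal_pow, Real.sq_sqrt hpos.le]; push_cast; ring)
        exact ⟨_, hpq, fun h => absurd hi h⟩
      · have hDR : (D i : ℝ) = (r - l i) ^ 2 + 4 * ((r : ℝ) + 1) := by
          rw [hz i hi]; exact_mod_cast hDz i
        have hpos : 0 < (D i : ℝ) := by rw [hDR]; positivity
        obtain ⟨p, q, hpq1, hpq⟩ := exists_transitionMatrix_qGraph_apply hreg (helC i) hne
          (D := (√(D i : ℝ) : ℝ)) (by exact_mod_cast (Real.sqrt_pos.2 hpos).ne')
          (by rw [← Complex.ofReal_pow, Real.sq_sqrt hpos.le, hDR]; push_cast; ring)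
        refine ⟨_, hpq, fun _ => ?_⟩
        have hE := hm ⟨i, hi, hi2⟩
        have hlim : Tendsto (fun n => Complex.exp (-Complex.I * (Real.pi / g : ℝ) * l i) *
            (p * (Complex.exp ((2 * Real.pi * √(D i : ℝ) * (1 / (2 * g) + m n) : ℝ) *
              Complex.I))⁻¹ +
            q * Complex.exp ((2 * Real.pi * √(D i : ℝ) * (1 / (2 * g) + m n) : ℝ) * Complex.I)))
            atTop (𝓝 (Complex.exp (-Complex.I * (Real.pi / g : ℝ) * l i) * (p * 1⁻¹ + q * 1))) :=
          (((hE.inv₀ one_ne_zero).const_mul p).add (hE.const_mul q)).const_mul _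
        rw [inv_one, mul_one, mul_one, hpq1, mul_one] at hlim
        refine hlim.congr fun n => ?_
        have h1 := hτint n (z i)
        rw [← Complex.ofReal_intCast, ← hz i hi] at h1
        have hP : Complex.exp (Complex.I * τ n * ((r + 2 : ℂ) / 2)) *
            Complex.exp (-Complex.I * τ n * ((r + 2 + l i + (√(D i : ℝ) : ℝ)) / 2)) =
            Complex.exp (-Complex.I * τ n * (l i / 2)) *
              (Complex.exp ((2 * Real.pi * √(D i : ℝ) * (1 / (2 * g) + m n) : ℝ) *
                Complex.I))⁻¹ := by
          rw [← Complex.exp_neg, ← Complex.exp_add, ← Complex.exp_add]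
          congr 1
          simp only [τ]
          push_cast
          ring
        have hQ : Complex.exp (Complex.I * τ n * ((r + 2 : ℂ) / 2)) *
            Complex.exp (-Complex.I * τ n * ((r + 2 + l i - (√(D i : ℝ) : ℝ)) / 2)) =
            Complex.exp (-Complex.I * τ n * (l i / 2)) *
              Complex.exp ((2 * Real.pi * √(D i : ℝ) * (1 / (2 * g) + m n) : ℝ) *
                Complex.I) := by
          rw [← Complex.exp_add, ← Complex.exp_add]
          congr 1
          simp only [τ]
          push_cast
          ring
        rw [← h1]
        linear_combination -p * hP - q * hQ
  choose f hf hflim using hcoef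
  -- The amplitude in the Q-graph, expanded in the eigenbasis.
  have hamp : ∀ t, pairState (Sum.inl a) (Sum.inl b) ⬝ᵥ
      (transitionMatrix (qGraph G) t *ᵥ pairState (Sum.inl c) (Sum.inl d)) =
      ∑ i, ((e i a - e i b : ℝ) : ℂ) * f i t * ((e i c - e i d : ℝ) : ℂ) := by
    intro t
    have h1 : (pairState (Sum.inl a) (Sum.inl b) : V ⊕ G.edgeSet → ℂ) =
        ∑ i, ((e i a - e i b : ℝ) : ℂ) • Sum.elim (fun v => (e i v : ℂ)) 0 := by
      rw [pairState_inl, hdec]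
      funext y
      rcases y with v | w <;> simp [Finset.sum_apply]
    rw [Matrix.dotProduct_mulVec, ← Matrix.mulVec_transpose, (transitionMatrix_isSymm _ t).eq,
      dotProduct_pairState, h1, Matrix.mulVec_sum, Finset.sum_apply, Finset.sum_apply,
      ← Finset.sum_sub_distrib]
    refine Finset.sum_congr rfl fun i _ => ?_
    rw [Matrix.mulVec_smul, Pi.smul_apply, Pi.smul_apply, hf, hf, smul_eq_mul, smul_eq_mul]
    push_cast
    ring
  obtain ⟨-, hcd, -, χ, hχ, hU⟩ := hpst
  have hsum : ∑ i, ((e i a - e i b : ℝ) : ℂ) *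
      Complex.exp (-Complex.I * (Real.pi / g : ℝ) * l i) * ((e i c - e i d : ℝ) : ℂ) = χ * 2 := by
    have h1 := congrArg (fun y => y ⬝ᵥ pairState c d) hU
    simp only [dotProduct_pairState] at h1
    have h2 : (χ • pairState c d) c - (χ • pairState c d) d = χ * 2 := by
      simp [pairState, hcd, hcd.symm]; ring
    rw [← h2, ← h1, hdec, Matrix.mulVec_sum, Finset.sum_apply, Finset.sum_apply,
      ← Finset.sum_sub_distrib]
    refine Finset.sum_congr rfl fun i _ => ?_
    rw [Matrix.mulVec_smul, transitionMatrix_mulVec_of_eigenvector G (helC i)]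
    simp only [Pi.smul_apply, smul_eq_mul]
    push_cast
    ring
  have hlim : Tendsto (fun n => Complex.exp (Complex.I * τ n * ((r + 2 : ℂ) / 2)) *
      (pairState (Sum.inl a) (Sum.inl b) ⬝ᵥ
        (transitionMatrix (qGraph G) (τ n) *ᵥ pairState (Sum.inl c) (Sum.inl d))))
      atTop (𝓝 (χ * 2)) := by
    rw [← hsum]
    simp only [hamp, Finset.mul_sum]
    refine tendsto_finsetSum _ fun i _ => ?_
    by_cases hi : e i a - e i b = 0
    · simp [hi]
    · refine (((hflim i hi).const_mul ((e i a - e i b : ℝ) : ℂ)).mul_const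
        ((e i c - e i d : ℝ) : ℂ)).congr fun n => ?_
      ring
  intro ε hε
  have hnorm := ((hlim.const_mul (1 / 2 : ℂ)).norm).pow 2
  have hone : ‖(1 / 2 : ℂ) * (χ * 2)‖ ^ 2 = 1 := by
    rw [show (1 / 2 : ℂ) * (χ * 2) = χ by ring, hχ, one_pow]
  rw [hone] at hnorm
  obtain ⟨n, hn⟩ := (hnorm.eventually_const_lt (sub_lt_self 1 hε)).exists
  refine ⟨τ n, hn.trans_eq ?_⟩
  have hphase : ‖Complex.exp (Complex.I * τ n * ((r + 2 : ℂ) / 2))‖ = 1 := by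
    have : Complex.I * τ n * ((r + 2 : ℂ) / 2) = ((τ n * ((r + 2) / 2) : ℝ) : ℂ) * Complex.I := by
      push_cast; ring
    rw [this, Complex.norm_exp_ofReal_mul_I]
  rw [norm_mul, norm_mul (Complex.exp _), hphase, one_mul, ← norm_mul]

end

end PairTransfer

theorem theorem4p2 {V : Type*} [Fintype V] [DecidableEq V]
    (G : SimpleGraph V) [DecidableRel G.Adj] (hconn : G.Connected)
    (r : ℕ) (hreg : G.IsRegularOfDegree r) (hr : (r + 1).Prime)
    (a b c d : V) (g : ℕ) (hg : 0 < g)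
    (hpst : PairTransfer.HasPairLPSTAt G a b c d (Real.pi / (g : ℝ))) :
    (¬ G.IsBipartite →
      PairTransfer.HasPairLPGST (PairTransfer.qGraph G)
        (Sum.inl a) (Sum.inl b) (Sum.inl c) (Sum.inl d)) ∧
    (∀ V₁ V₂ : Set V, G.IsBipartiteWith V₁ V₂ → V₁ ∪ V₂ = Set.univ →
      ((a ∈ V₁ ∧ b ∈ V₁ ∨ a ∈ V₂ ∧ b ∈ V₂) →
        PairTransfer.HasPairLPGST (PairTransfer.qGraph G)
          (Sum.inl a) (Sum.inl b) (Sum.inl c) (Sum.inl d)) ∧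
      (a ∈ V₁ → b ∈ V₂ → 2 * g ∣ r + 2 →
        PairTransfer.HasPairLPGST (PairTransfer.qGraph G)
          (Sum.inl a) (Sum.inl b) (Sum.inl c) (Sum.inl d))) := by
  refine ⟨fun hG => ?_, fun V₁ V₂ hG _ => ⟨fun hab => ?_, fun _ _ hdvd => ?_⟩⟩
  · refine PairTransfer.hasPairLPGST_qGraph hconn hreg hr hg hpst (Or.inl fun x hx => ?_)
    rw [PairTransfer.eq_zero_of_eigenvector_of_not_isBipartite hconn hreg hG hx a,
      PairTransfer.eq_zero_of_eigenvector_of_not_isBipartite hconn hreg hG hx b]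
  · exact PairTransfer.hasPairLPGST_qGraph hconn hreg hr hg hpst
      (Or.inl fun x hx => PairTransfer.eq_of_eigenvector_of_same_part hconn hreg hG hx hab)
  · exact PairTransfer.hasPairLPGST_qGraph hconn hreg hr hg hpst (Or.inr hdvd)
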